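/- **Theorem (Companion-Jordan form).** Let $H$ be a field with $\mathbb{Q}\subset H\subset\mathbb{C}$ and let $A\in H^{n\times n}$. For a monic polynomial $g(\lambda)=\lambda^k+a_{k-1}\lambda^{k-1}+\cdots+a_0\in H[\lambda]$ let $C_g$ be its $k\times k$ companion matrix, with ones on the first superdiagonal, last row $(-a_0,-a_1,\ldots,-a_{k-1})$, and zeros elsewhere. For $d\ge 1$ let $N_d$ be the $d\times d$ matrix with ones on the first superdiagonal and zeros elsewhere. The matrix $A$ has elementary divisors over $H$: there are monic polynomials $g_1,\ldots,g_r\in H[\lambda]$, irreducible over $H$ and not necessarily distinct, and integers $d_1,\ldots,d_r\ge 1$, such that the $H[\lambda]$-module $H^n$, on which $\lambda$ acts as $A$, is isomorphic to $\bigoplus_{j=1}^r H[\lambda]/(g_j^{d_j})$. For every such system $g_1^{d_1},\ldots,g_r^{d_r}$ of elementary divisors, with $k_j=\deg g_j$, one has $$p_A(\lambda)=\det(\lambda I_n-A)=\prod_{j=1}^r g_j(\lambda)^{d_j},\qquad \sum_{j=1}^r k_jd_j=n,$$ and there is an invertible matrix $T\in H^{n\times n}$ such that $$A=T^{-1}(C_1\oplus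 C_2\oplus\cdots\oplus C_r)T,\qquad C_j=I_{d_j}\otimes C_{g_j}+N_{d_j}\otimes I_{k_j}=\begin{bmatrix} C_{g_j} & I_{k_j} & & 0\\ & C_{g_j} & \ddots & \\ & & \ddots & I_{k_j}\\ 0 & & & C_{g_j} \end{bmatrix}\in H^{d_jk_j\times d_jk_j}.$$ This form is unique up to permutation of the blocks: if $A$ is similar over $H$ both to $C_1\oplus\cdots\oplus C_r$ and to $C_1'\oplus\cdots\oplus C_{r'}'$, where $C_j=I_{d_j}\otimes C_{g_j}+N_{d_j}\otimes I_{k_j}$ and $C_j'=I_{d_j'}\otimes C_{g_j'}+N_{d_j'}\otimes I_{k_j'}$ with all $g_j,g_j'\in H[\lambda]$ monic and irreducible over $H$, of degrees $k_j,k_j'$, and all $d_j,d_j'\ge 1$, then $r=r'$ and there is a permutation $\sigma$ of $\{1,\ldots,r\}$ with $g_{\sigma(j)}'=g_j$ and $d_{\sigma(j)}'=d_j$ (hence $C_{\sigma(j)}'=C_j$) for all $j$. -/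

import Mathlib

open Polynomial
open scoped Kronecker DirectSum

namespace CompanionJordan

variable {K : Type*} [Field K]

/-- The companion matrix `C_g` of `g = λ^k + a_{k-1} λ^{k-1} + ⋯ + a_0`: ones on the superdiagonal
and last row `-a_0, …, -a_{k-1}`. -/
def companion (g : K[X]) : Matrix (Fin g.natDegree) (Fin g.natDegree) K :=
  Matrix.of fun i j =>
    if (i : ℕ) + 1 = g.natDegree then -g.coeff j
    else if (i : ℕ) + 1 = j then 1 else 0

/-- The `d × d` matrix with ones on the superdiagonal and zeros elsewhere. -/
def shift (K : Type*) [Field K] (d : ℕ) : Matrix (Fin d) (Fin d) K :=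
  Matrix.of fun i j => if (i : ℕ) + 1 = j then 1 else 0

/-- The block `I_d ⊗ C_g + N ⊗ I_k`, `k = deg g`: the `dk × dk` block upper bidiagonal matrix with
`C_g` on the diagonal and `I_k` on the superdiagonal. -/
def block (g : K[X]) (d : ℕ) : Matrix (Fin (d * g.natDegree)) (Fin (d * g.natDegree)) K :=
  Matrix.reindex finProdFinEquiv finProdFinEquiv
    ((1 : Matrix (Fin d) (Fin d) K) ⊗ₖ companion g +
      shift K d ⊗ₖ (1 : Matrix (Fin g.natDegree) (Fin g.natDegree) K))

/-- The direct sum `C_1 ⊕ ⋯ ⊕ C_r` of the blocks of the pairs `(g_j, d_j)`, in this order. -/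
def blockSum {r : ℕ} (g : Fin r → K[X]) (d : Fin r → ℕ) :
    Matrix (Fin (∑ j, d j * (g j).natDegree)) (Fin (∑ j, d j * (g j).natDegree)) K :=
  Matrix.reindex finSigmaFinEquiv finSigmaFinEquiv
    (Matrix.blockDiagonal' fun j => block (g j) (d j))

/-- `A = T⁻¹ (C_1 ⊕ ⋯ ⊕ C_r) T` for an invertible `T` with entries in `K`; in particular the sizes
of the blocks add up to `n`. -/
def IsSimilarToBlockSum {n r : ℕ} (A : Matrix (Fin n) (Fin n) K)
    (g : Fin r → K[X]) (d : Fin r → ℕ) : Prop :=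
  ∃ h : ∑ j, d j * (g j).natDegree = n, ∃ T : GL (Fin n) K,
    A = ((T⁻¹ : GL (Fin n) K) : Matrix (Fin n) (Fin n) K) *
      Matrix.reindex (finCongr h) (finCongr h) (blockSum g d) * (T : Matrix (Fin n) (Fin n) K)

/-- The `g_j` are monic irreducible polynomials and the `d_j` are positive. -/
def IsPrimePowerFamily {r : ℕ} (g : Fin r → K[X]) (d : Fin r → ℕ) : Prop :=
  ∀ j, (g j).Monic ∧ Irreducible (g j) ∧ 0 < d j

/-- The elementary divisors of `A` (listed with repetition) are `g_1^{d_1}, …, g_r^{d_r}`: the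
`K[X]`-module `K^n`, on which `X` acts as `A`, is the direct sum of primary cyclic modules
`K[X] / (g_j^{d_j})`. -/
def IsElementaryDivisors {n r : ℕ} (A : Matrix (Fin n) (Fin n) K)
    (g : Fin r → K[X]) (d : Fin r → ℕ) : Prop :=
  IsPrimePowerFamily g d ∧
    Nonempty (Module.AEval' (Matrix.toLin' A) ≃ₗ[K[X]]
      ⨁ j : Fin r, K[X] ⧸ Submodule.span K[X] {g j ^ d j})

end CompanionJordan

namespace CompanionJordan

variable {K : Type*} [Field K]

/-! A block is `S + N` with `S = I ⊗ C_g` and `N` the shift tensored with `I`, which commute. In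
characteristic zero `g` is separable, so `g'(S)` is invertible and Taylor expansion gives `g(S + N)
= N U` with `U` a unit commuting with `N` (`exists_isUnit_aeval_add`). Hence `g ^ d` kills the block
and `g ^ (d - 1)` does not. As the block has size `deg (g ^ d)`, it is cyclic with module `K[X] / (g
^ d)`. Similarity to a block sum is therefore the same as an isomorphism of `K[X]`-modules
(`isSimilarToBlockSum_iff`). Existence comes from the structure theorem over a PID. Uniqueness holds
because the ranks of the powers of each prime `p` on the module determine the exponents
(`card_fiber_eq`). -/

/-! ### Companion matrices, Kronecker products and the shift. -/

theorem companion_eq_transpose_leftMulMatrix {g : K[X]} (hg : g.Monic) :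
    companion g = (Algebra.leftMulMatrix (AdjoinRoot.powerBasis hg.ne_zero).basis
      (AdjoinRoot.powerBasis hg.ne_zero).gen).transpose := by
  rw [PowerBasis.leftMulMatrix, PowerBasis.minpolyGen_eq,
    AdjoinRoot.minpoly_powerBasis_gen_of_monic hg]
  ext i j
  simp only [companion, Matrix.of_apply, eq_comm]
  rfl

theorem aeval_companion {g : K[X]} (hg : g.Monic) : aeval (companion g) g = 0 := by
  have h : aeval (Algebra.leftMulMatrix (AdjoinRoot.powerBasis hg.ne_zero).basis
      (AdjoinRoot.powerBasis hg.ne_zero).gen) g = 0 := by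
    rw [aeval_algHom_apply, AdjoinRoot.powerBasis_gen, AdjoinRoot.aeval_eq, AdjoinRoot.mk_self,
      map_zero]
  have htr : ∀ {m : ℕ} (M : Matrix (Fin m) (Fin m) K) (f : K[X]),
      aeval M.transpose f = (aeval M f).transpose := fun M f => by
    simp [aeval_eq_sum_range, Matrix.transpose_sum, Matrix.transpose_pow]
  rw [companion_eq_transpose_leftMulMatrix hg]
  exact (htr _ g).trans ((congrArg Matrix.transpose h).trans Matrix.transpose_zero)

theorem aeval_one_kronecker {m n : Type*} [Fintype m] [DecidableEq m] [Fintype n] [DecidableEq n]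
    (M : Matrix n n K) (f : K[X]) :
    aeval ((1 : Matrix m m K) ⊗ₖ M) f = (1 : Matrix m m K) ⊗ₖ aeval M f := by
  induction f using Polynomial.induction_on' with
  | add p q hp hq => rw [map_add, map_add, hp, hq, Matrix.kronecker_add]
  | monomial k a =>
    have hpow : ((1 : Matrix m m K) ⊗ₖ M) ^ k = (1 : Matrix m m K) ⊗ₖ (M ^ k) := by
      induction k with
      | zero => simp
      | succ k ih => rw [pow_succ, ih, ← Matrix.mul_kronecker_mul, one_mul, pow_succ]
    rw [aeval_monomial, aeval_monomial, hpow, Algebra.algebraMap_eq_smul_one,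
      Algebra.algebraMap_eq_smul_one, smul_one_mul, smul_one_mul, Matrix.kronecker_smul]

theorem kronecker_one_pow {m n : Type*} [Fintype m] [DecidableEq m] [Fintype n] [DecidableEq n]
    (M : Matrix m m K) (k : ℕ) :
    (M ⊗ₖ (1 : Matrix n n K)) ^ k = (M ^ k) ⊗ₖ (1 : Matrix n n K) := by
  induction k with
  | zero => simp
  | succ k ih => rw [pow_succ, ih, ← Matrix.mul_kronecker_mul, one_mul, pow_succ]

theorem shift_pow_apply (d m : ℕ) (i j : Fin d) :
    (shift K d ^ m) i j = if (i : ℕ) + m = j then 1 else 0 := by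
  induction m generalizing i with
  | zero => simp [Matrix.one_apply, Fin.ext_iff]
  | succ m ih =>
    rw [pow_succ', Matrix.mul_apply]
    have hs : ∀ b, shift K d i b = if (i : ℕ) + 1 = b then 1 else 0 := fun _ => rfl
    simp only [ih, hs, ite_mul, one_mul, zero_mul]
    by_cases h : (i : ℕ) + 1 < d
    · rw [Finset.sum_eq_single (⟨i + 1, h⟩ : Fin d)]
      · simp [add_assoc, add_comm 1 m]
      · intro b _ hb
        rw [if_neg]
        exact fun hb' => hb (Fin.ext hb'.symm)
      · simp
    · rw [Finset.sum_eq_zero, if_neg]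
      · omega
      · intro b _
        rw [if_neg]
        omega

theorem shift_pow_self (d : ℕ) : shift K d ^ d = 0 := by
  ext i j
  rw [shift_pow_apply, if_neg (by omega), Matrix.zero_apply]

theorem shift_pow_pred_ne_zero {d : ℕ} (hd : 0 < d) : shift K d ^ (d - 1) ≠ 0 := by
  intro h
  have := congrFun (congrFun h ⟨0, hd⟩) ⟨d - 1, by omega⟩
  rw [shift_pow_apply] at this
  simp at this

/-! ### Minimal polynomial, cyclicity and characteristic polynomial of a block. -/

/-- If `g` is separable and vanishes at `S`, then `g (S + N) = N U` with a unit `U` commuting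
with `N`, for every nilpotent `N` commuting with `S`. -/
theorem exists_isUnit_aeval_add {R : Type*} [Ring R] [Algebra K R] {g : K[X]} (hg : g.Separable)
    {S N : R} (hS : aeval S g = 0) (hN : IsNilpotent N) (hSN : Commute S N) :
    ∃ U : R, IsUnit U ∧ Commute N U ∧ aeval (S + N) g = N * U := by
  have hcomm : ∀ f : K[X], Commute ((aeval S : K[X] →ₐ[K] R).toRingHom f) N := fun f => by
    induction f using Polynomial.induction_on' with
    | add p q hp hq => rw [map_add]; exact hp.add_left hq
    | monomial k a =>
      change Commute (aeval S (monomial k a)) N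
      rw [aeval_monomial]
      exact (Algebra.commute_algebraMap_left a N).mul_left (hSN.pow_left k)
  -- `R` need not be commutative, so the Taylor expansion is done in `K[X][X]` and carried over by
  -- `φ`, which sends `C X` to `S` and `X` to `N`.
  let φ : K[X][X] →+* R := eval₂RingHom' (aeval S : K[X] →ₐ[K] R).toRingHom N hcomm
  have hφC : ∀ f : K[X], φ (C f) = aeval S f := fun f => by
    change eval₂ _ _ (C f) = _
    rw [eval₂_C]; rfl
  have hφX : φ X = N := by
    change eval₂ _ _ X = _
    rw [eval₂_X]
  have hev : ∀ (f : K[X]) (z : K[X][X]), φ ((f.map (C.comp C)).eval z) = aeval (φ z) f := by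
    intro f z
    rw [eval_map, hom_eval₂, aeval_def]
    congr 1
    ext a
    simp [hφC]
  obtain ⟨k, hk⟩ := binomExpansion (g.map ((C : K[X] →+* K[X][X]).comp C)) (C X) X
  have hk' := congrArg φ hk
  rw [derivative_map, map_add, map_add, map_mul, map_mul, map_pow, hev, hev, hev, map_add, hφC,
    aeval_X, hφX, hS, zero_add] at hk'
  have hkN : Commute N (φ k) := by
    rw [← hφX]; exact (Commute.all X k).map φ
  have hdN : Commute N (aeval S (derivative g)) := (hcomm _).symm
  refine ⟨aeval S (derivative g) + φ k * N, ?_, hdN.add_right (hkN.mul_right (Commute.refl N)), ?_⟩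
  -- The Bézout identity `a g + b g' = 1` evaluated at `S` inverts `g'(S)`; adding a commuting
  -- nilpotent keeps it a unit.
  · have hu : IsUnit (aeval S (derivative g)) := by
      obtain ⟨a, b, hab⟩ := hg
      have h1 := congrArg (aeval S) hab
      rw [map_add, map_mul, map_mul, hS, mul_zero, zero_add, map_one] at h1
      have h2 := h1
      rw [← map_mul, mul_comm, map_mul] at h2
      exact ⟨⟨_, _, h2, h1⟩, rfl⟩
    refine IsNilpotent.isUnit_add_left_of_commute (hkN.symm.isNilpotent_mul_left hN) hu ?_
    have h3 : Commute (φ k) (aeval S (derivative g)) := by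
      rw [← hφC]; exact (Commute.all k _).map φ
    exact h3.mul_left hdN
  · rw [hk', mul_add, ← hdN.eq, pow_two, ← mul_assoc N, hkN.eq, mul_assoc]

/-- The block of `(g, d)`, indexed by pairs, is annihilated by `g ^ d` but not by `g ^ (d - 1)`. -/
theorem aeval_kroneckerBlock {g : K[X]} (hg : g.Monic) (hgs : g.Separable) (hk : 0 < g.natDegree)
    {d : ℕ} (hd : 0 < d) :
    aeval ((1 : Matrix (Fin d) (Fin d) K) ⊗ₖ companion g +
      shift K d ⊗ₖ (1 : Matrix (Fin g.natDegree) (Fin g.natDegree) K)) (g ^ d) = 0 ∧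
    aeval ((1 : Matrix (Fin d) (Fin d) K) ⊗ₖ companion g +
      shift K d ⊗ₖ (1 : Matrix (Fin g.natDegree) (Fin g.natDegree) K)) (g ^ (d - 1)) ≠ 0 := by
  have hN : (shift K d ⊗ₖ (1 : Matrix (Fin g.natDegree) (Fin g.natDegree) K)) ^ d = 0 := by
    rw [kronecker_one_pow, shift_pow_self, Matrix.zero_kronecker]
  obtain ⟨U, hU, hNU, h⟩ := exists_isUnit_aeval_add hgs
    (S := (1 : Matrix (Fin d) (Fin d) K) ⊗ₖ companion g)
    (N := shift K d ⊗ₖ (1 : Matrix (Fin g.natDegree) (Fin g.natDegree) K))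
    (by rw [aeval_one_kronecker, aeval_companion hg, Matrix.kronecker_zero])
    ⟨d, hN⟩
    (by rw [commute_iff_eq, ← Matrix.mul_kronecker_mul, ← Matrix.mul_kronecker_mul]; simp)
  rw [map_pow, map_pow, h, hNU.mul_pow, hNU.mul_pow, hN, zero_mul]
  refine ⟨rfl, fun h0 => ?_⟩
  rw [(hU.pow _).mul_left_eq_zero, kronecker_one_pow] at h0
  apply shift_pow_pred_ne_zero (K := K) hd
  ext i j
  have := congrFun (congrFun h0 (i, ⟨0, hk⟩)) (j, ⟨0, hk⟩)
  simpa [Matrix.kroneckerMap_apply] using this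

theorem aeval_block (g f : K[X]) (d : ℕ) :
    aeval (block g d) f = Matrix.reindex finProdFinEquiv finProdFinEquiv
      (aeval ((1 : Matrix (Fin d) (Fin d) K) ⊗ₖ companion g +
        shift K d ⊗ₖ (1 : Matrix (Fin g.natDegree) (Fin g.natDegree) K)) f) :=
  aeval_algHom_apply (Matrix.reindexAlgEquiv K K finProdFinEquiv) _ f

theorem pow_dvd_of_dvd_pow_of_not_dvd_pow_pred {g q : K[X]} (hg : Prime g) {d : ℕ}
    (h : q ∣ g ^ d) (h' : ¬ q ∣ g ^ (d - 1)) : g ^ d ∣ q := by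
  obtain ⟨i, hi, hqi⟩ := (dvd_prime_pow hg d).1 h
  obtain rfl | hlt := hi.eq_or_lt
  · exact hqi.symm.dvd
  · exact absurd (hqi.dvd.trans (pow_dvd_pow g (by omega))) h'

/-- A matrix of size `natDegree (g ^ d)` annihilated by `g ^ d` but not by `g ^ (d - 1)` acts on
its space as `X` acts on `K[X] / (g ^ d)`. -/
theorem exists_linearEquiv_quotient_pow {ι : Type*} [Fintype ι] [DecidableEq ι] {g : K[X]}
    (hg : Irreducible g) {d : ℕ} (B : Matrix ι ι K)
    (hcard : Fintype.card ι = (g ^ d).natDegree)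
    (h0 : aeval B (g ^ d) = 0) (h1 : aeval B (g ^ (d - 1)) ≠ 0) :
    ∃ e : (ι → K) ≃ₗ[K] (K[X] ⧸ Submodule.span K[X] {g ^ d}),
      ∀ v, e (B.mulVec v) = (X : K[X]) • e v := by
  -- The annihilator of `v` is generated by a divisor of `g ^ d` not dividing `g ^ (d - 1)`, hence
  -- by `g ^ d`: `v` will be a cyclic vector.
  obtain ⟨v, hv⟩ : ∃ v, (aeval B (g ^ (d - 1))).mulVec v ≠ 0 := by
    by_contra! h
    exact h1 (Matrix.ext_of_mulVec_single fun i => by rw [h, Matrix.zero_mulVec])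
  let a := Matrix.toLin' B
  have haev : ∀ f : K[X], aeval a f = Matrix.toLin' (aeval B f) := fun f =>
    aeval_algHom_apply (Matrix.toLinAlgEquiv' (R := K) (n := ι)) B f
  let w : Module.AEval' a := Module.AEval'.of a v
  have hw : ∀ f : K[X], f • w = Module.AEval'.of a ((aeval B f).mulVec v) := fun f => by
    have := (Module.AEval.of_aeval_smul a f v).symm
    rw [haev] at this
    exact this
  obtain ⟨q, hq⟩ : ∃ q, Submodule.span K[X] {q} =
      LinearMap.ker (LinearMap.toSpanSingleton K[X] _ w) :=
    ⟨_, Submodule.IsPrincipal.span_singleton_generator _⟩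
  have hqmem : ∀ f : K[X], q ∣ f ↔ f • w = 0 := fun f => by
    rw [← LinearMap.toSpanSingleton_apply, ← LinearMap.mem_ker, ← hq,
      ← Ideal.mem_span_singleton]
  have hqd : g ^ d ∣ q := by
    have h2 : q ∣ g ^ d := by rw [hqmem, hw, h0, Matrix.zero_mulVec, map_zero]
    refine pow_dvd_of_dvd_pow_of_not_dvd_pow_pred hg.prime h2 fun h3 => ?_
    rw [hqmem, hw] at h3
    exact hv ((Module.AEval'.of a).map_eq_zero_iff.1 h3)
  have hker : LinearMap.ker (LinearMap.toSpanSingleton K[X] _ w) =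
      Submodule.span K[X] {g ^ d} := by
    rw [← hq]
    have h2 : q ∣ g ^ d := by rw [hqmem, hw, h0, Matrix.zero_mulVec, map_zero]
    exact Ideal.span_singleton_eq_span_singleton.2 (associated_of_dvd_dvd h2 hqd)
  let F : (K[X] ⧸ Submodule.span K[X] {g ^ d}) →ₗ[K[X]] Module.AEval' a :=
    (Submodule.span K[X] {g ^ d}).liftQ (LinearMap.toSpanSingleton K[X] _ w) hker.ge
  have hF : Function.Injective F := by
    rw [← LinearMap.ker_eq_bot]
    exact Submodule.ker_liftQ_eq_bot _ _ _ hker.le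
  let F' : (K[X] ⧸ Submodule.span K[X] {g ^ d}) →ₗ[K] (ι → K) :=
    (Module.AEval'.of a).symm.toLinearMap ∘ₗ F.restrictScalars K
  have hF' : Function.Injective F' := (Module.AEval'.of a).symm.injective.comp hF
  -- Equality of dimensions makes the injective map bijective.
  have hfr : Module.finrank K (K[X] ⧸ Submodule.span K[X] {g ^ d}) = Module.finrank K (ι → K) := by
    rw [Module.finrank_fintype_fun_eq_card, hcard]
    exact finrank_quotient_span_eq_natDegree
  have : FiniteDimensional K (K[X] ⧸ Submodule.span K[X] {g ^ d}) :=
    FiniteDimensional.of_injective F' hF'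
  let E := LinearEquiv.ofBijective F'
    ⟨hF', (LinearMap.injective_iff_surjective_of_finrank_eq_finrank hfr).1 hF'⟩
  refine ⟨E.symm, fun v => ?_⟩
  rw [LinearEquiv.symm_apply_eq]
  change _ = (Module.AEval'.of a).symm (F (X • E.symm v))
  rw [map_smul]
  change _ = (Module.AEval'.of a).symm (X • Module.AEval'.of a (F' (E.symm v)))
  rw [Module.AEval'.X_smul_of, LinearEquiv.symm_apply_apply]
  change _ = a (E (E.symm v))
  rw [LinearEquiv.apply_symm_apply]
  rfl

theorem aeval_block_pow [PerfectField K] {g : K[X]} (hg : g.Monic) (hgi : Irreducible g)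
    {d : ℕ} (hd : 0 < d) :
    aeval (block g d) (g ^ d) = 0 ∧ aeval (block g d) (g ^ (d - 1)) ≠ 0 := by
  obtain ⟨h0, h1⟩ := aeval_kroneckerBlock hg
    (PerfectField.separable_of_irreducible hgi) hgi.natDegree_pos hd
  constructor
  · rw [aeval_block, h0]; rfl
  · rw [aeval_block]
    exact fun h => h1 ((Matrix.reindex _ _).injective h)

theorem exists_linearEquiv_block [PerfectField K] {g : K[X]} (hg : g.Monic) (hgi : Irreducible g)
    {d : ℕ} (hd : 0 < d) :
    ∃ e : (Fin (d * g.natDegree) → K) ≃ₗ[K] (K[X] ⧸ Submodule.span K[X] {g ^ d}),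
      ∀ v, e ((block g d).mulVec v) = (X : K[X]) • e v := by
  obtain ⟨h0, h1⟩ := aeval_block_pow hg hgi hd
  exact exists_linearEquiv_quotient_pow hgi _ (by rw [Fintype.card_fin, natDegree_pow]) h0 h1

/-- `g ^ d` divides the minimal polynomial, hence the characteristic polynomial, and both are monic
of the same degree. -/
theorem charpoly_block [PerfectField K] {g : K[X]} (hg : g.Monic) (hgi : Irreducible g)
    {d : ℕ} (hd : 0 < d) : (block g d).charpoly = g ^ d := by
  obtain ⟨h0, h1⟩ := aeval_block_pow hg hgi hd
  have hdvd : g ^ d ∣ (block g d).charpoly :=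
    (pow_dvd_of_dvd_pow_of_not_dvd_pow_pred hgi.prime (minpoly.dvd K _ h0)
      (fun h => h1 ((minpoly.dvd_iff).1 h))).trans (Matrix.minpoly_dvd_charpoly _)
  refine eq_of_monic_of_dvd_of_natDegree_le (hg.pow d) (Matrix.charpoly_monic _) hdvd ?_
  rw [Matrix.charpoly_natDegree_eq_dim, Fintype.card_fin, natDegree_pow]

/-! ### Direct sums of blocks, and similarity as module isomorphism. -/

theorem blockDiagonal'_mulVec {ι : Type*} [Fintype ι] [DecidableEq ι] {m : ι → Type*}
    [∀ i, Fintype (m i)] (M : ∀ i, Matrix (m i) (m i) K) (v : (Σ i, m i) → K) (i : ι) (a : m i) :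
    (Matrix.blockDiagonal' M).mulVec v ⟨i, a⟩ = (M i).mulVec (fun b => v ⟨i, b⟩) a := by
  simp only [Matrix.mulVec, dotProduct, Fintype.sum_sigma]
  rw [Finset.sum_eq_single i]
  · simp [Matrix.blockDiagonal'_apply_eq]
  · intro k _ hk
    exact Finset.sum_eq_zero fun b _ => by
      rw [Matrix.blockDiagonal'_apply_ne M a b hk.symm, zero_mul]
  · simp

theorem charpoly_blockDiagonal' {ι : Type*} [Fintype ι] [LinearOrder ι] {m : ι → Type*}
    [∀ i, Fintype (m i)] [∀ i, DecidableEq (m i)] (M : ∀ i, Matrix (m i) (m i) K) :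
    (Matrix.blockDiagonal' M).charpoly = ∏ i, (M i).charpoly := by
  have h : (Matrix.blockDiagonal' M).charmatrix =
      Matrix.blockDiagonal' fun i => (M i).charmatrix := by
    rw [Matrix.charmatrix]
    ext ⟨i, a⟩ ⟨j, b⟩ : 1
    by_cases hij : i = j
    · subst hij
      by_cases hab : a = b <;> simp [Matrix.charmatrix, Matrix.blockDiagonal'_apply_eq, hab]
    · simp [Matrix.blockDiagonal'_apply_ne, hij]
  rw [Matrix.charpoly, h, (Matrix.blockTriangular_blockDiagonal' _).det_fintype]
  refine Finset.prod_congr rfl fun i _ => ?_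
  rw [Matrix.charpoly, ← Matrix.det_reindex_self (Equiv.sigmaSubtype i)]
  congr 1
  ext a b : 1
  exact Matrix.blockDiagonal'_apply_eq (fun i => (M i).charmatrix) i a b

theorem charpoly_blockSum [PerfectField K] {r : ℕ} {g : Fin r → K[X]} {d : Fin r → ℕ}
    (h : IsPrimePowerFamily g d) : (blockSum g d).charpoly = ∏ j, g j ^ d j := by
  rw [blockSum, Matrix.charpoly_reindex, charpoly_blockDiagonal']
  exact Finset.prod_congr rfl fun j _ => charpoly_block (h j).1 (h j).2.1 (h j).2.2

theorem IsSimilarToBlockSum.charpoly_eq [PerfectField K] {n r : ℕ} {A : Matrix (Fin n) (Fin n) K}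
    {g : Fin r → K[X]} {d : Fin r → ℕ} (h : IsPrimePowerFamily g d)
    (hA : IsSimilarToBlockSum A g d) : A.charpoly = ∏ j, g j ^ d j := by
  obtain ⟨hn, T, rfl⟩ := hA
  rw [Matrix.coe_units_inv, Matrix.charpoly_units_conj', Matrix.charpoly_reindex, charpoly_blockSum h]

/-- The direct product of the spaces of the blocks carries the direct product of their actions. -/
theorem exists_linearEquiv_blockSum [PerfectField K] {r : ℕ} {g : Fin r → K[X]} {d : Fin r → ℕ}
    (h : IsPrimePowerFamily g d) :
    ∃ e : (Fin (∑ j, d j * (g j).natDegree) → K) ≃ₗ[K]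
        (Π j, K[X] ⧸ Submodule.span K[X] {g j ^ d j}),
      ∀ v, e ((blockSum g d).mulVec v) = (X : K[X]) • e v := by
  choose e he using fun j => exists_linearEquiv_block (h j).1 (h j).2.1 (h j).2.2
  refine ⟨(LinearEquiv.funCongrLeft K K finSigmaFinEquiv).trans
    ((LinearEquiv.piCurry K fun _ _ => K).trans (LinearEquiv.piCongrRight e)), fun v => ?_⟩
  funext j
  change e j _ = (X : K[X]) • e j (fun a => v (finSigmaFinEquiv ⟨j, a⟩))
  rw [← he]
  congr 1
  funext a
  change (blockSum g d).mulVec v (finSigmaFinEquiv ⟨j, a⟩) = _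
  rw [← blockDiagonal'_mulVec (fun j => block (g j) (d j)) (fun x => v (finSigmaFinEquiv x)),
    blockSum, Matrix.reindex_apply, Matrix.submatrix_mulVec_equiv]
  simp [Function.comp_def]

theorem nonempty_aeval_equiv_iff {n r : ℕ} {A : Matrix (Fin n) (Fin n) K}
    {g : Fin r → K[X]} {d : Fin r → ℕ} :
    Nonempty (Module.AEval' (Matrix.toLin' A) ≃ₗ[K[X]]
      ⨁ j : Fin r, K[X] ⧸ Submodule.span K[X] {g j ^ d j}) ↔
    ∃ e : (Fin n → K) ≃ₗ[K] (Π j, K[X] ⧸ Submodule.span K[X] {g j ^ d j}),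
      ∀ v, e (A.mulVec v) = (X : K[X]) • e v := by
  let D := DirectSum.linearEquivFunOnFintype K[X] (Fin r)
    fun j => K[X] ⧸ Submodule.span K[X] {g j ^ d j}
  constructor
  · rintro ⟨e⟩
    refine ⟨(Module.AEval'.of (Matrix.toLin' A)).trans ((e.trans D).restrictScalars K),
      fun v => ?_⟩
    change (e.trans D) (Module.AEval'.of _ (Matrix.toLin' A v)) = _
    rw [← Module.AEval'.X_smul_of, map_smul]
    rfl
  · rintro ⟨e, he⟩
    exact ⟨(LinearEquiv.ofAEval (Matrix.toLin' A) e he).trans D.symm⟩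

theorem isSimilarToBlockSum_iff [PerfectField K] {n r : ℕ} {A : Matrix (Fin n) (Fin n) K}
    {g : Fin r → K[X]} {d : Fin r → ℕ} (h : IsPrimePowerFamily g d) :
    IsSimilarToBlockSum A g d ↔
    ∃ e : (Fin n → K) ≃ₗ[K] (Π j, K[X] ⧸ Submodule.span K[X] {g j ^ d j}),
      ∀ v, e (A.mulVec v) = (X : K[X]) • e v := by
  obtain ⟨E, hE⟩ := exists_linearEquiv_blockSum h
  constructor
  · rintro ⟨rfl, T, hT⟩
    refine ⟨(Matrix.GeneralLinearGroup.toLin T).toLinearEquiv.trans E, fun v => ?_⟩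
    change E ((T : Matrix _ _ K).mulVec (A.mulVec v)) = (X : K[X]) • E ((T : Matrix _ _ K).mulVec v)
    rw [← hE, Matrix.mulVec_mulVec, Matrix.mulVec_mulVec, hT, ← mul_assoc, ← mul_assoc]
    simp
  · rintro ⟨e, he⟩
    let f := e.trans E.symm
    -- The sizes agree because `f` preserves dimension; after substitution the reindexing is
    -- trivial.
    obtain rfl : ∑ j, d j * (g j).natDegree = n := by
      simpa using f.finrank_eq.symm
    have hf : ∀ v, f (A.mulVec v) = (blockSum g d).mulVec (f v) := fun v => by
      change E.symm (e _) = _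
      rw [LinearEquiv.symm_apply_eq, he, hE]
      simp [f]
    let T : GL (Fin (∑ j, d j * (g j).natDegree)) K :=
      Matrix.GeneralLinearGroup.toLin.symm (LinearMap.GeneralLinearGroup.ofLinearEquiv f)
    have hT : ∀ v, (T : Matrix _ _ K).mulVec v = f v := fun v => by
      change Matrix.toLin' (LinearMap.toMatrix' (f : _ →ₗ[K] _)) v = f v
      rw [Matrix.toLin'_toMatrix']
      rfl
    refine ⟨rfl, T, ?_⟩
    have : (T : Matrix _ _ K) * A = blockSum g d * (T : Matrix _ _ K) := by
      refine Matrix.toLin'.injective (LinearMap.ext fun v => ?_)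
      simp only [Matrix.toLin'_apply, ← Matrix.mulVec_mulVec, hT, hf]
    rw [mul_assoc]
    change A = _ * (blockSum g d * _)
    rw [← this, ← mul_assoc]
    simp

/-! ### Uniqueness through ranks of powers of a prime. -/

theorem finrank_range_lsmul_congr {M N : Type*} [AddCommGroup M] [Module K[X] M] [Module K M]
    [IsScalarTower K K[X] M] [AddCommGroup N] [Module K[X] N] [Module K N]
    [IsScalarTower K K[X] N] (e : M ≃ₗ[K[X]] N) (q : K[X]) :
    Module.finrank K (LinearMap.range (LinearMap.lsmul K[X] M q)) =
      Module.finrank K (LinearMap.range (LinearMap.lsmul K[X] N q)) := by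
  have h : (LinearMap.range (LinearMap.lsmul K[X] M q)).map (e : M →ₗ[K[X]] N) =
      LinearMap.range (LinearMap.lsmul K[X] N q) := by
    rw [← LinearMap.range_comp]
    have : (e : M →ₗ[K[X]] N) ∘ₗ LinearMap.lsmul K[X] M q =
        LinearMap.lsmul K[X] N q ∘ₗ (e : M →ₗ[K[X]] N) := by
      ext x; simp
    rw [this, LinearMap.range_comp, LinearEquiv.range, Submodule.map_top]
  rw [← h]
  exact ((e.submoduleMap _).restrictScalars K).finrank_eq

theorem finrank_range_lsmul_pi {ι : Type*} [Fintype ι] (M : ι → Type*)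
    [∀ i, AddCommGroup (M i)] [∀ i, Module K[X] (M i)] [∀ i, Module K (M i)]
    [∀ i, IsScalarTower K K[X] (M i)] [∀ i, Module.Finite K (M i)] (q : K[X]) :
    Module.finrank K (LinearMap.range (LinearMap.lsmul K[X] (Π i, M i) q)) =
      ∑ i, Module.finrank K (LinearMap.range (LinearMap.lsmul K[X] (M i) q)) := by
  let F : LinearMap.range (LinearMap.lsmul K[X] (Π i, M i) q) →ₗ[K[X]]
      (Π i, LinearMap.range (LinearMap.lsmul K[X] (M i) q)) :=
    LinearMap.pi fun i => (LinearMap.proj i ∘ₗ Submodule.subtype _).codRestrict _ (by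
      rintro ⟨_, x, rfl⟩
      exact ⟨x i, rfl⟩)
  have hF : Function.Bijective F := by
    constructor
    · intro x y hxy
      ext i
      exact congrArg Subtype.val (congrFun hxy i)
    · intro y
      choose x hx using fun i => (y i).2
      refine ⟨⟨_, x, rfl⟩, ?_⟩
      funext i
      exact Subtype.ext (hx i)
  have : ∀ i, Module.Finite K (LinearMap.range (LinearMap.lsmul K[X] (M i) q)) := fun i =>
    Module.Finite.of_injective ((Submodule.subtype _).restrictScalars K) Subtype.val_injective
  rw [((LinearEquiv.ofBijective F hF).restrictScalars K).finrank_eq, Module.finrank_pi_fintype]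

/-- The image of `s` is cyclic, generated by the class of `s`, and `h` says that its annihilator is
`(t)`. -/
theorem finrank_range_lsmul_quotient {q s t : K[X]} (h : ∀ f, q ∣ f * s ↔ t ∣ f) :
    Module.finrank K (LinearMap.range
      (LinearMap.lsmul K[X] (K[X] ⧸ Submodule.span K[X] {q}) s)) = t.natDegree := by
  let F : K[X] →ₗ[K[X]] (K[X] ⧸ Submodule.span K[X] {q}) :=
    LinearMap.lsmul K[X] _ s ∘ₗ Submodule.mkQ _
  have hF : LinearMap.range F =
      LinearMap.range (LinearMap.lsmul K[X] (K[X] ⧸ Submodule.span K[X] {q}) s) := by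
    rw [LinearMap.range_comp, Submodule.range_mkQ, Submodule.map_top]
  have hk : LinearMap.ker F = Submodule.span K[X] {t} := by
    ext f
    change s • (Submodule.Quotient.mk f : K[X] ⧸ Submodule.span K[X] {q}) = 0 ↔ f ∈ Ideal.span {t}
    rw [← Submodule.Quotient.mk_smul, Submodule.Quotient.mk_eq_zero, Ideal.mem_span_singleton,
      Ideal.mem_span_singleton, ← h, smul_eq_mul, mul_comm]
  rw [← hF, ← (F.quotKerEquivRange.restrictScalars K).finrank_eq, hk]
  exact finrank_quotient_span_eq_natDegree

-- On a factor with `g ≠ p`, `p ^ m` is coprime to `g ^ d` and acts invertibly. For `g = p` the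
-- truncated `d - m` covers `m > d`, where the image is zero.
open Classical in
theorem finrank_range_lsmul_pow {p g : K[X]} (hp : Irreducible p) (hpm : p.Monic)
    (hg : Irreducible g) (hgm : g.Monic) (d m : ℕ) :
    Module.finrank K (LinearMap.range
      (LinearMap.lsmul K[X] (K[X] ⧸ Submodule.span K[X] {g ^ d}) (p ^ m))) =
      if g = p then (d - m) * p.natDegree else d * g.natDegree := by
  split_ifs with hgp
  · subst hgp
    rw [finrank_range_lsmul_quotient (t := g ^ (d - m)), natDegree_pow]
    intro f
    obtain hle | hlt := le_or_gt m d
    · conv_lhs => rw [← Nat.sub_add_cancel hle, pow_add]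
      exact mul_dvd_mul_iff_right (pow_ne_zero _ hg.ne_zero)
    · rw [Nat.sub_eq_zero_of_le hlt.le, pow_zero]
      exact iff_of_true ((pow_dvd_pow g hlt.le).mul_left f) (one_dvd f)
  · rw [finrank_range_lsmul_quotient (t := g ^ d), natDegree_pow]
    intro f
    have hcop : IsCoprime g p := by
      refine (hg.coprime_iff_not_dvd).2 fun hdvd => hgp ?_
      exact eq_of_monic_of_associated hgm hpm (hg.associated_of_dvd hp hdvd)
    exact ⟨(IsCoprime.pow hcop).dvd_of_dvd_mul_right, fun hf => hf.mul_right _⟩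

theorem finite_quotient_span_singleton {g : K[X]} (hg : g ≠ 0) :
    Module.Finite K (K[X] ⧸ Submodule.span K[X] {g}) :=
  (AdjoinRoot.powerBasis hg).finite

-- From `p ^ k` to `p ^ (k + 1)` the rank drops by `deg p` times the number of `j` with `g j = p`
-- and `d j > k`. Differencing these counts at `m - 1` and `m` isolates the exponent `m`. If `p` is
-- not monic irreducible or `m = 0`, both fibres are empty.
open Classical in
theorem card_fiber_eq {r r' : ℕ} {g : Fin r → K[X]} {d : Fin r → ℕ} {g' : Fin r' → K[X]}
    {d' : Fin r' → ℕ} (h : IsPrimePowerFamily g d) (h' : IsPrimePowerFamily g' d')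
    (e : (Π j, K[X] ⧸ Submodule.span K[X] {g j ^ d j}) ≃ₗ[K[X]]
      (Π j, K[X] ⧸ Submodule.span K[X] {g' j ^ d' j})) (p : K[X]) (m : ℕ) :
    (Finset.univ.filter fun j => g j = p ∧ d j = m).card =
      (Finset.univ.filter fun j => g' j = p ∧ d' j = m).card := by
  by_cases hp : Irreducible p ∧ p.Monic ∧ 0 < m
  · obtain ⟨hp, hpm, hm⟩ := hp
    have hrank : ∀ {s : ℕ} {f : Fin s → K[X]} {c : Fin s → ℕ}, IsPrimePowerFamily f c → ∀ k,
        Module.finrank K (LinearMap.range (LinearMap.lsmul K[X]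
          (Π j, K[X] ⧸ Submodule.span K[X] {f j ^ c j}) (p ^ k))) =
        ∑ j, if f j = p then (c j - k) * p.natDegree else c j * (f j).natDegree := by
      intro s f c hf k
      have := fun j => finite_quotient_span_singleton (pow_ne_zero (c j) (hf j).2.1.ne_zero)
      rw [finrank_range_lsmul_pi]
      exact Finset.sum_congr rfl fun j _ =>
        finrank_range_lsmul_pow hp hpm (hf j).2.1 (hf j).1 _ _
    have hstep : ∀ {s : ℕ} (f : Fin s → K[X]) (c : Fin s → ℕ) (k : ℕ),
        (∑ j, if f j = p then (c j - k) * p.natDegree else c j * (f j).natDegree) =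
        (∑ j, if f j = p then (c j - (k + 1)) * p.natDegree else c j * (f j).natDegree) +
          (Finset.univ.filter fun j => f j = p ∧ k < c j).card * p.natDegree := by
      intro s f c k
      rw [Finset.card_filter, Finset.sum_mul, ← Finset.sum_add_distrib]
      refine Finset.sum_congr rfl fun j _ => ?_
      by_cases hj : f j = p
      · by_cases hk : k < c j
        · obtain ⟨t, ht⟩ := Nat.exists_eq_add_of_lt hk
          simp only [hj, hk, if_true, and_self, ← add_mul]
          congr 1
          omega
        · simp [hj, hk, Nat.sub_eq_zero_of_le (not_lt.1 hk),
            Nat.sub_eq_zero_of_le (Nat.le_succ_of_le (not_lt.1 hk))]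
      · simp [hj]
    have hgt : ∀ k, (Finset.univ.filter fun j => g j = p ∧ k < d j).card =
        (Finset.univ.filter fun j => g' j = p ∧ k < d' j).card := by
      intro k
      have h0 := finrank_range_lsmul_congr e (p ^ k)
      have h1 := finrank_range_lsmul_congr e (p ^ (k + 1))
      rw [hrank h, hrank h'] at h0 h1
      rw [hstep g d, hstep g' d', h1] at h0
      exact Nat.eq_of_mul_eq_mul_right hp.natDegree_pos (Nat.add_left_cancel h0)
    have hsplit : ∀ {s : ℕ} (f : Fin s → K[X]) (c : Fin s → ℕ),
        (Finset.univ.filter fun j => f j = p ∧ m - 1 < c j).card =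
        (Finset.univ.filter fun j => f j = p ∧ c j = m).card +
          (Finset.univ.filter fun j => f j = p ∧ m < c j).card := by
      intro s f c
      rw [← Finset.card_union_of_disjoint, ← Finset.filter_or]
      · congr 1
        ext j
        simp only [Finset.mem_filter, Finset.mem_univ, true_and, ← and_or_left]
        refine and_congr_right fun _ => ?_
        omega
      · rw [Finset.disjoint_filter]
        rintro j _ ⟨_, h1⟩ ⟨_, h2⟩
        omega
    have h1 := hgt (m - 1)
    rw [hsplit g d, hsplit g' d', hgt m] at h1
    exact Nat.add_right_cancel h1
  · rw [Finset.filter_false_of_mem, Finset.filter_false_of_mem]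
    · rfl
    · rintro j _ ⟨rfl, rfl⟩
      exact hp ⟨(h' j).2.1, (h' j).1, (h' j).2.2⟩
    · rintro j _ ⟨rfl, rfl⟩
      exact hp ⟨(h j).2.1, (h j).1, (h j).2.2⟩

/-- Uniqueness of the decomposition into primary cyclic modules. -/
theorem exists_equiv_of_pi_quotient_equiv {r r' : ℕ} {g : Fin r → K[X]} {d : Fin r → ℕ}
    {g' : Fin r' → K[X]} {d' : Fin r' → ℕ} (h : IsPrimePowerFamily g d)
    (h' : IsPrimePowerFamily g' d')
    (e : (Π j, K[X] ⧸ Submodule.span K[X] {g j ^ d j}) ≃ₗ[K[X]]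
      (Π j, K[X] ⧸ Submodule.span K[X] {g' j ^ d' j})) :
    ∃ σ : Fin r ≃ Fin r', ∀ j, g' (σ j) = g j ∧ d' (σ j) = d j := by
  classical
  have hfib : ∀ c : K[X] × ℕ, Nonempty ({j // (g j, d j) = c} ≃ {j // (g' j, d' j) = c}) := by
    rintro ⟨p, m⟩
    refine ⟨Fintype.equivOfCardEq ?_⟩
    simpa only [Fintype.card_subtype, Prod.mk.injEq] using card_fiber_eq h h' e p m
  refine ⟨Equiv.ofFiberEquiv fun c => (hfib c).some, fun j => ?_⟩
  exact Prod.mk.inj (Equiv.ofFiberEquiv_map (f := fun j => (g j, d j))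
    (g := fun j => (g' j, d' j)) (fun c => (hfib c).some) j)

theorem exists_equiv_of_isSimilarToBlockSum [PerfectField K] {n r r' : ℕ}
    {A : Matrix (Fin n) (Fin n) K} {g : Fin r → K[X]} {d : Fin r → ℕ}
    {g' : Fin r' → K[X]} {d' : Fin r' → ℕ} (h : IsPrimePowerFamily g d)
    (h' : IsPrimePowerFamily g' d') (hA : IsSimilarToBlockSum A g d)
    (hA' : IsSimilarToBlockSum A g' d') :
    ∃ σ : Fin r ≃ Fin r', ∀ j, g' (σ j) = g j ∧ d' (σ j) = d j := by
  obtain ⟨e, he⟩ := (isSimilarToBlockSum_iff h).1 hA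
  obtain ⟨e', he'⟩ := (isSimilarToBlockSum_iff h').1 hA'
  exact exists_equiv_of_pi_quotient_equiv h h'
    ((LinearEquiv.ofAEval (Matrix.toLin' A) e he).symm.trans
      (LinearEquiv.ofAEval (Matrix.toLin' A) e' he'))

/-! ### Existence of elementary divisors. -/

theorem exists_isElementaryDivisors {n : ℕ} (A : Matrix (Fin n) (Fin n) K) :
    ∃ (r : ℕ) (g : Fin r → K[X]) (d : Fin r → ℕ), IsElementaryDivisors A g d := by
  classical
  obtain ⟨ι, _, p, hp, k, ⟨e⟩⟩ := Module.equiv_directSum_of_isTorsion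
    (Module.AEval.isTorsion_of_finiteDimensional K (Fin n → K) (Matrix.toLin' A))
  -- The structure theorem allows zero exponents and non-monic primes: the former give trivial
  -- factors, dropped here, and the latter are normalized in `hspan`.
  let J := {i // 0 < k i}
  let E : Fin (Fintype.card J) ≃ J := (Fintype.equivFin J).symm
  let F : (Π i, K[X] ⧸ Submodule.span K[X] {p i ^ k i}) →ₗ[K[X]]
      (Π j : J, K[X] ⧸ Submodule.span K[X] {p j ^ k j}) :=
    LinearMap.pi fun j => LinearMap.proj (j : ι)
  have hF : Function.Bijective F := by
    constructor
    · intro x y hxy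
      funext i
      by_cases hi : 0 < k i
      · exact congrFun hxy ⟨i, hi⟩
      · have : Subsingleton (K[X] ⧸ Submodule.span K[X] {p i ^ k i}) := by
          rw [Submodule.Quotient.subsingleton_iff, Nat.eq_zero_of_not_pos hi, pow_zero]
          exact Ideal.span_singleton_one
        exact Subsingleton.elim _ _
    · intro y
      refine ⟨fun i => if hi : 0 < k i then y ⟨i, hi⟩ else 0, ?_⟩
      funext j
      exact dif_pos j.2
  have hspan : ∀ j, Submodule.span K[X] {p (E j) ^ k (E j)} =
      Submodule.span K[X] {normalize (p (E j)) ^ k (E j)} := fun j =>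
    Ideal.span_singleton_eq_span_singleton.2 ((normalize_associated _).symm.pow_pow)
  refine ⟨Fintype.card J, fun j => normalize (p (E j)), fun j => k (E j),
    fun j => ⟨monic_normalize (hp _).ne_zero,
      (normalize_associated _).symm.irreducible (hp _), (E j).2⟩, ⟨?_⟩⟩
  exact e.trans ((DirectSum.linearEquivFunOnFintype K[X] ι _).trans
    ((LinearEquiv.ofBijective F hF).trans
      ((LinearEquiv.piCongrLeft K[X]
          (fun j : J => K[X] ⧸ Submodule.span K[X] {p j ^ k j}) E).symm.trans
        ((LinearEquiv.piCongrRight fun j => Submodule.quotEquivOfEq _ _ (hspan j)).trans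
          (DirectSum.linearEquivFunOnFintype K[X] _ _).symm))))

end CompanionJordan

theorem mainTheorem2 (H : Subfield ℂ) (n : ℕ) (A : Matrix (Fin n) (Fin n) H) :
    (∃ (r : ℕ) (g : Fin r → Polynomial H) (d : Fin r → ℕ),
      CompanionJordan.IsElementaryDivisors A g d) ∧
    (∀ (r : ℕ) (g : Fin r → Polynomial H) (d : Fin r → ℕ),
      CompanionJordan.IsElementaryDivisors A g d →
        A.charpoly = ∏ j, g j ^ d j ∧ CompanionJordan.IsSimilarToBlockSum A g d) ∧
    (∀ (r r' : ℕ) (g : Fin r → Polynomial H) (d : Fin r → ℕ)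
        (g' : Fin r' → Polynomial H) (d' : Fin r' → ℕ),
      CompanionJordan.IsPrimePowerFamily g d → CompanionJordan.IsPrimePowerFamily g' d' →
      CompanionJordan.IsSimilarToBlockSum A g d → CompanionJordan.IsSimilarToBlockSum A g' d' →
        ∃ σ : Fin r ≃ Fin r', ∀ j, g' (σ j) = g j ∧ d' (σ j) = d j) := by
  refine ⟨CompanionJordan.exists_isElementaryDivisors A, fun r g d h => ?_,
    fun r r' g d g' d' h h' hA hA' =>
      CompanionJordan.exists_equiv_of_isSimilarToBlockSum h h' hA hA'⟩
  have hA := (CompanionJordan.isSimilarToBlockSum_iff h.1).2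
    (CompanionJordan.nonempty_aeval_equiv_iff.1 h.2)
  exact ⟨hA.charpoly_eq h.1, hA⟩
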